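/- Let $n$ be a prime with $n \equiv \pm 3 \pmod 8$, and let $s$ be an integer with $0 < s < n$, $s \ne 2$ and $s \ne n-2$. Then the trinomial $x^n + x^s + 1$ is reducible over $\mathrm{GF}(2)$, i.e. it is the product of two polynomials of positive degree in $\mathrm{GF}(2)[x]$. -/

import Mathlib

/-! If the trinomial is irreducible, it has a root `b` in GF(2^n); passing to `b⁻¹` if necessary,
the middle exponent `k` is even. The root lifts to the Witt vectors, where its `n` Frobenius
conjugates are all the roots of `X ^ n + X ^ k + 1`. Frobenius permutes them in an `n`-cycle, an
even permutation, so their Vandermonde determinant is a fixed unit and its square is 1 mod 8. Up to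
sign this square is the product of the derivative's values at the roots, which the trinomial formula
shows to be `n` mod 8, since `k ≥ 4` gives `8 ∣ k ^ k`. Hence `n ≡ ±1` mod 8. This is
Stickelberger's parity argument, carried by `eight_dvd_of_trinomial_root`. -/

/-! ### Root products and Vandermonde determinants -/

open Polynomial in
theorem Polynomial.Monic.eq_prod_X_sub_C_of_injective {R : Type*} [CommRing R] [IsDomain R] {n : ℕ}
    {F : R[X]} (hF : F.Monic) (hdeg : F.natDegree = n) {v : Fin n → R}
    (hv : Function.Injective v) (hroot : ∀ i, F.eval (v i) = 0) :
    F = ∏ i, (X - C (v i)) := by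
  have hmon : (∏ i, (X - C (v i))).Monic := monic_prod_of_monic _ _ fun i _ => monic_X_sub_C _
  refine eq_of_monic_of_dvd_of_natDegree_le hmon hF ?_ ?_
  · have h : (Finset.univ.val.map v).map (fun a => X - C a) =
        Finset.univ.val.map fun i => X - C (v i) :=
      Multiset.map_map _ _ _
    rw [Finset.prod, ← h, Multiset.prod_X_sub_C_dvd_iff_le_roots hF.ne_zero,
      Multiset.le_iff_subset (Finset.univ.nodup.map hv)]
    intro a ha
    obtain ⟨i, -, rfl⟩ := Multiset.mem_map.1 ha
    exact (mem_roots hF.ne_zero).2 (hroot i)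
  · rw [hdeg, natDegree_prod_of_monic _ _ fun i _ => monic_X_sub_C _]
    simp

open Polynomial in
theorem Polynomial.eval_derivative_prod_X_sub_C {R ι : Type*} [CommRing R] [Fintype ι]
    [DecidableEq ι] (v : ι → R) (i : ι) :
    (derivative (∏ j, (X - C (v j)))).eval (v i) = ∏ j ∈ {i}ᶜ, (v i - v j) := by
  rw [← Finset.prod_mul_prod_compl {i}, Finset.prod_singleton, derivative_mul]
  simp [eval_prod]

-- The sign is (-1)^(n(n-1)/2); leaving it open costs nothing, as the target is `n ≡ ±1` mod 8.
open Polynomial in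
theorem Polynomial.prod_eval_derivative_eq_or_neg {R : Type*} [CommRing R] {n : ℕ}
    (v : Fin n → R) :
    ∏ i, (derivative (∏ j, (X - C (v j)))).eval (v i) = (Matrix.vandermonde v).det ^ 2 ∨
    ∏ i, (derivative (∏ j, (X - C (v j)))).eval (v i) = -(Matrix.vandermonde v).det ^ 2 := by
  have h : ∏ i, (derivative (∏ j, (X - C (v j)))).eval (v i) =
      (∏ i : Fin n, ∏ j ∈ Finset.Ioi i, (-1)) * (Matrix.vandermonde v).det ^ 2 := by
    simp_rw [eval_derivative_prod_X_sub_C]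
    rw [← Finset.prod_prod_Ioi_mul_eq_prod_prod_off_diag (fun j i => v i - v j),
      Matrix.det_vandermonde, ← Finset.prod_pow, ← Finset.prod_mul_distrib]
    refine Finset.prod_congr rfl fun i _ => ?_
    rw [← Finset.prod_pow, ← Finset.prod_mul_distrib]
    exact Finset.prod_congr rfl fun j _ => by ring
  rw [h]
  simp only [Finset.prod_const, Finset.prod_pow_eq_pow_sum]
  exact (neg_one_pow_eq_or R _).imp (fun h => by rw [h, one_mul]) (fun h => by rw [h, neg_one_mul])

theorem Matrix.map_det_vandermonde_of_finRotate {R : Type*} [CommRing R] {n : ℕ} (hn : Odd n)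
    (σ : R →+* R) (v : Fin n → R) (hσ : ∀ i, σ (v i) = v (finRotate n i)) :
    σ (vandermonde v).det = (vandermonde v).det := by
  have h : σ.mapMatrix (vandermonde v) = (vandermonde v).submatrix (finRotate n) id := by
    ext i j
    simp [vandermonde_apply, hσ]
  obtain ⟨m, rfl⟩ := hn
  rw [RingHom.map_det, h, det_permute]
  simp [sign_finRotate]

/-! ### 2-adic arithmetic in Witt vectors -/

section WittVector

open WittVector

variable {K : Type*} [Field K] [CharP K 2]

theorem WittVector.two_dvd_iff_coeff_zero [PerfectRing K 2] (x : WittVector 2 K) :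
    2 ∣ x ↔ x.coeff 0 = 0 := by
  have := mem_span_p_iff_coeff_zero_eq_zero x
  rwa [Ideal.mem_span_singleton, Nat.cast_ofNat] at this

theorem WittVector.coeff_zero_of_frobenius_eq {x : WittVector 2 K} (hx : frobenius x = x) :
    x.coeff 0 = 0 ∨ x.coeff 0 = 1 := by
  have h : x.coeff 0 ^ 2 = x.coeff 0 := by rw [← coeff_frobenius_charP, hx]
  have : x.coeff 0 * (x.coeff 0 - 1) = 0 := by linear_combination h
  rcases mul_eq_zero.1 this with h | h
  · exact Or.inl h
  · exact Or.inr (sub_eq_zero.1 h)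

theorem WittVector.two_ne_zero : (2 : WittVector 2 K) ≠ 0 := by
  exact_mod_cast p_nonzero 2 K

/-- Fixed points of Frobenius behave like 2-adic integers: for `x = 1 + 2y`, `y` is fixed too, and
`x² - 1 = 4(y + y²)` with `y + y²` even. -/
theorem WittVector.eight_dvd_sq_sub_one_of_frobenius_eq [PerfectRing K 2] {x : WittVector 2 K}
    (hx : frobenius x = x) (h0 : x.coeff 0 ≠ 0) : 8 ∣ x ^ 2 - 1 := by
  have h1 : x.coeff 0 = 1 := (coeff_zero_of_frobenius_eq hx).resolve_left h0
  have hc : constantCoeff (x - 1) = 0 := by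
    rw [map_sub, map_one]; exact sub_eq_zero.2 h1
  obtain ⟨y, hy⟩ := (two_dvd_iff_coeff_zero (x - 1)).2 hc
  obtain rfl : x = 1 + 2 * y := by linear_combination hy
  have hy' : frobenius y = y := by
    have h : (2 : WittVector 2 K) * frobenius y = 2 * y := by
      simpa only [map_add, map_mul, map_one, map_ofNat, add_right_inj] using hx
    exact mul_left_cancel₀ WittVector.two_ne_zero h
  have hz : constantCoeff (y + y ^ 2) = 0 := by
    rw [map_add, map_pow]
    change y.coeff 0 + y.coeff 0 ^ 2 = 0
    rcases coeff_zero_of_frobenius_eq hy' with h | h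
    · simp [h]
    · rw [h, one_pow, CharTwo.add_self_eq_zero]
  obtain ⟨z, hz⟩ := (two_dvd_iff_coeff_zero (y + y ^ 2)).2 hz
  exact ⟨z, by linear_combination 4 * hz⟩

theorem WittVector.eight_dvd_intCast [PerfectRing K 2] {a : ℤ} (h : (8 : WittVector 2 K) ∣ a) :
    8 ∣ a := by
  have key : ∀ b : ℤ, (2 : WittVector 2 K) ∣ b → 2 ∣ b := by
    intro b hb
    by_contra hodd
    obtain ⟨c, rfl⟩ := Int.not_even_iff_odd.1 (fun h => hodd h.two_dvd)
    push_cast at hb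
    rw [two_dvd_iff_coeff_zero] at hb
    change constantCoeff (2 * (c : WittVector 2 K) + 1) = 0 at hb
    rw [map_add, map_mul, map_ofNat, map_one, CharTwo.two_eq_zero, zero_mul, zero_add] at hb
    exact one_ne_zero hb
  have cancel : ∀ (m b : ℤ), ((2 * m : ℤ) : WittVector 2 K) ∣ ((2 * b : ℤ) : WittVector 2 K) →
      (m : WittVector 2 K) ∣ b := by
    intro m b hb
    push_cast at hb
    exact (mul_dvd_mul_iff_left WittVector.two_ne_zero).1 hb
  obtain ⟨b, rfl⟩ := key a ((show (2 : WittVector 2 K) ∣ 8 from ⟨4, by norm_num⟩).trans h)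
  have h4 := cancel 4 b (by exact_mod_cast h)
  obtain ⟨c, rfl⟩ := key b ((show (2 : WittVector 2 K) ∣ 4 from ⟨2, by norm_num⟩).trans
    (by exact_mod_cast h4))
  have h2 := cancel 2 c (by exact_mod_cast h4)
  obtain ⟨d, rfl⟩ := key c (by exact_mod_cast h2)
  exact ⟨d, by ring⟩

open Polynomial in
theorem WittVector.exists_root_coeff_zero_eq [PerfectRing K 2] {F : (WittVector 2 K)[X]}
    (hF : F.Monic) {b : K}
    (h0 : (F.map constantCoeff).eval b = 0)
    (h1 : (derivative (F.map constantCoeff)).eval b ≠ 0) :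
    ∃ a : WittVector 2 K, F.eval a = 0 ∧ constantCoeff a = b := by
  obtain ⟨a₀, ha₀⟩ := constantCoeff_surjective 2 (R := K) b
  have mem (x : WittVector 2 K) : x ∈ Ideal.span {((2 : ℕ) : WittVector 2 K)} ↔
      constantCoeff x = 0 := mem_span_p_iff_coeff_zero_eq_zero x
  obtain ⟨a, ha, hb⟩ := HenselianRing.is_henselian
    (I := Ideal.span {((2 : ℕ) : WittVector 2 K)}) F hF a₀
    (by rw [mem, ← h0, ← ha₀, eval_map_apply])
    (by
      refine (Ideal.Quotient.mk _).isUnit_map (isUnit_of_coeff_zero_ne_zero _ ?_)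
      rw [derivative_map, ← ha₀, eval_map_apply] at h1
      exact h1)
  rw [mem, map_sub, sub_eq_zero] at hb
  exact ⟨a, ha, hb.trans ha₀⟩

end WittVector

/-- The period of `b` under squaring divides the prime `n`, and only 0 and 1 have period 1. -/
theorem pow_two_pow_injective {K : Type*} [Field K] {n : ℕ} (hn : n.Prime) {b : K}
    (hb : b ^ 2 ^ n = b) (h0 : b ≠ 0) (h1 : b ≠ 1) :
    Function.Injective fun i : Fin n => b ^ 2 ^ (i : ℕ) := by
  have : Fact n.Prime := ⟨hn⟩
  have hper : Function.minimalPeriod (fun x : K => x ^ 2) b = n := by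
    refine Function.minimalPeriod_eq_prime ?_ fun h => ?_
    · rw [Function.IsPeriodicPt, Function.IsFixedPt, pow_iterate]
      exact hb
    · have h : b ^ 2 = b := h
      have h2 : b * (b - 1) = 0 := by linear_combination h
      rcases mul_eq_zero.1 h2 with h | h
      · exact h0 h
      · exact h1 (sub_eq_zero.1 h)
  intro i j hij
  refine Fin.ext (Function.iterate_injOn_Iio_minimalPeriod (f := fun x : K => x ^ 2) (x := b)
    (by simp [hper]) (by simp [hper]) ?_)
  simpa only [pow_iterate] using hij

/-! ### Trinomials and their discriminant -/

open Polynomial in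
theorem Polynomial.trinomial_monic_and_natDegree (R : Type*) [CommRing R] [Nontrivial R] {n k : ℕ}
    (hkn : k < n) :
    (X ^ n + X ^ k + 1 : R[X]).Monic ∧ (X ^ n + X ^ k + 1 : R[X]).natDegree = n := by
  have h : (X ^ k + 1 : R[X]).degree < n := by
    refine (degree_add_le _ _).trans_lt (max_lt ?_ ?_)
    · rw [degree_X_pow]
      exact_mod_cast hkn
    · rw [degree_one]
      exact_mod_cast (Nat.zero_le k).trans_lt hkn
  rw [add_assoc]
  refine ⟨monic_X_pow_add h, ?_⟩
  rw [natDegree_eq_of_degree_eq (degree_add_eq_left_of_degree_lt (by rwa [degree_X_pow])),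
    natDegree_X_pow]

open Polynomial in
theorem Polynomial.trinomial_eq_prod {R : Type*} [CommRing R] [IsDomain R] {n k : ℕ}
    (hkn : k < n) {v : Fin n → R} (hv : Function.Injective v)
    (hroot : ∀ i, v i ^ n + v i ^ k + 1 = 0) :
    (X ^ n + X ^ k + 1 : R[X]) = ∏ i, (X - C (v i)) := by
  obtain ⟨hm, hd⟩ := trinomial_monic_and_natDegree R hkn
  exact hm.eq_prod_X_sub_C_of_injective hd hv (by simpa using hroot)

open Polynomial in
/-- If `v` runs through the roots of `X ^ n + X ^ k + 1`, with `n` odd, `k` even and the `v i ^ k`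
distinct, the product of the values of the derivative is `n ^ n + (n - k) ^ (n - k) * k ^ k`;
the last factor is written with an inverse `u` of `n - k`. -/
theorem Polynomial.prod_eval_derivative_trinomial {R : Type*} [CommRing R] [IsDomain R] {n k : ℕ}
    (hn : Odd n) (hk : Even k) (hkn : k < n) (hk0 : k ≠ 0) {v : Fin n → R}
    (hv : Function.Injective fun i => v i ^ k) (hroot : ∀ i, v i ^ n + v i ^ k + 1 = 0)
    {u : R} (hu : ((n : R) - k) * u = 1) :
    ∏ i, (derivative (X ^ n + X ^ k + 1 : R[X])).eval (v i) =
      n ^ n + ((n : R) - k) ^ n * u ^ k * k ^ k := by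
  have hF := trinomial_eq_prod hkn (fun i j h => hv (by simp [h])) hroot
  -- Raising `v ^ n = -(1 + v ^ k)` to the even power `k` gives the equation satisfied by `v ^ k`.
  have hH : (X ^ n - (1 + X) ^ k : R[X]) = ∏ i, (X - C (v i ^ k)) := by
    have hdeg : ((1 + X) ^ k : R[X]).degree < n := by
      rw [degree_pow, add_comm, ← C_1, degree_X_add_C]
      simpa using hkn
    refine Monic.eq_prod_X_sub_C_of_injective (monic_X_pow_sub hdeg) ?_ hv fun i => ?_
    · rw [natDegree_eq_of_degree_eq (degree_sub_eq_left_of_degree_lt (by rwa [degree_X_pow])),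
        natDegree_X_pow]
    · have h : 1 + v i ^ k = -v i ^ n := by linear_combination hroot i
      simp only [eval_sub, eval_pow, eval_X, eval_add, eval_one]
      rw [h, hk.neg_pow]
      ring
  have hprod : ∏ i, v i = -1 := by
    have h := congrArg (eval 0) hF
    simp only [eval_add, eval_pow, eval_X, eval_one, eval_prod, eval_sub, eval_C, zero_sub,
      Finset.prod_neg, Finset.card_univ, Fintype.card_fin, hn.neg_one_pow, zero_pow hk0,
      zero_pow hn.pos.ne'] at h
    linear_combination h
  -- Eliminating `v ^ n` leaves an expression linear in `v ^ k`, so the product over `i` is a value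
  -- of the polynomial in `hH`, at `-(n * u)`.
  have hterm : ∀ i, v i * (derivative (X ^ n + X ^ k + 1 : R[X])).eval (v i) =
      ((n : R) - k) * (-(n * u) - v i ^ k) := by
    intro i
    simp only [derivative_add, derivative_X_pow, derivative_one, eval_add, eval_mul, eval_pow,
      eval_X, eval_C, eval_zero]
    have e (m : ℕ) (hm : m ≠ 0) : v i * v i ^ (m - 1) = v i ^ m := mul_pow_sub_one hm _
    linear_combination (n : R) * e n hn.pos.ne' + (k : R) * e k hk0 + n * hroot i + n * hu
  have h := Finset.prod_congr (rfl : Finset.univ = Finset.univ) fun i _ => hterm i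
  rw [Finset.prod_mul_distrib, Finset.prod_mul_distrib, hprod, Finset.prod_const,
    Finset.card_univ, Fintype.card_fin] at h
  have hH' := congrArg (eval (-(n * u))) hH
  simp only [eval_sub, eval_pow, eval_X, eval_add, eval_one, eval_prod, eval_C] at hH'
  rw [← hH', hn.neg_pow, show 1 + -(n * u) = -(u * k) by linear_combination -hu, hk.neg_pow,
    mul_pow, mul_pow] at h
  have hun : ((n : R) - k) ^ n * u ^ n = 1 := by rw [← mul_pow, hu, one_pow]
  linear_combination -h + (n : R) ^ n * hun

/-! ### The congruence modulo 8 -/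

open Polynomial WittVector in
theorem eight_dvd_of_trinomial_root {K : Type*} [Field K] [CharP K 2] [PerfectRing K 2]
    {n k : ℕ} (hn : n.Prime) (hodd : Odd n) (hk : Even k) (hk4 : 4 ≤ k) (hkn : k < n)
    (hK : ∀ x : K, x ^ 2 ^ n = x) {b : K} (hb : b ^ n + b ^ k + 1 = 0) :
    (8 : ℤ) ∣ n - 1 ∨ (8 : ℤ) ∣ n + 1 := by
  have hk0 : k ≠ 0 := by omega
  have hb0 : b ≠ 0 := by
    rintro rfl
    simp [hk0, hn.ne_zero] at hb
  have hbk1 : b ^ k ≠ 1 := by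
    intro h
    rw [h, add_assoc, CharTwo.add_self_eq_zero, add_zero] at hb
    exact hb0 (pow_eq_zero_iff hn.ne_zero |>.1 hb)
  have hn1 : (n : K) = 1 := by
    obtain ⟨m, rfl⟩ := hodd
    simp [CharTwo.two_eq_zero]
  have hk0' : (k : K) = 0 := by
    obtain ⟨m, rfl⟩ := hk
    simp [CharTwo.add_self_eq_zero]
  have hF := (trinomial_monic_and_natDegree (WittVector 2 K) hkn).1
  obtain ⟨a, ha, hab⟩ := exists_root_coeff_zero_eq hF (b := b) (by simpa using hb)
    (by simp [derivative_X_pow, hn1, hk0', hb0])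
  have hab' : a.coeff 0 = b := hab
  have ha' : a ^ n + a ^ k + 1 = 0 := by simpa using ha
  set v : Fin n → WittVector 2 K := fun i => frobenius^[i] a with hvdef
  have hvc (i : Fin n) : WittVector.constantCoeff (v i) = b ^ 2 ^ (i : ℕ) := by
    change (frobenius^[i] a).coeff 0 = _
    rw [iterate_frobenius_coeff, hab']
  have hvk : Function.Injective fun i => v i ^ k := by
    intro i j hij
    have h := congrArg WittVector.constantCoeff hij
    simp only [map_pow, hvc] at h
    refine pow_two_pow_injective hn (hK (b ^ k)) (pow_ne_zero _ hb0) hbk1 ?_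
    simpa only [← pow_mul, mul_comm k] using h
  have hroot : ∀ i, v i ^ n + v i ^ k + 1 = 0 := by
    intro i
    have h := congrArg (frobenius^[i]) ha'
    simpa only [iterate_map_add, iterate_map_pow, iterate_map_one, iterate_map_zero] using h
  have hrot : ∀ i, frobenius (v i) = v (finRotate n i) := by
    obtain ⟨m, rfl⟩ := Nat.exists_eq_succ_of_ne_zero hn.ne_zero
    intro i
    simp only [hvdef, ← Function.iterate_succ_apply', coe_finRotate]
    split_ifs with h
    -- The cycle closes: the `n`-th Frobenius iterate raises each Witt coordinate to the power `2 ^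
    -- n`, which is the identity on `K`.
    · subst h
      ext j
      rw [iterate_frobenius_coeff]
      exact hK _
    · rfl
  obtain ⟨u, hu⟩ : ∃ u : WittVector 2 K, ((n : WittVector 2 K) - k) * u = 1 := by
    have h : WittVector.constantCoeff ((n : WittVector 2 K) - (k : WittVector 2 K)) ≠ 0 := by
      rw [map_sub, map_natCast, map_natCast, hn1, hk0', sub_zero]
      exact one_ne_zero
    exact (isUnit_of_coeff_zero_ne_zero _ h).exists_right_inv
  have hvinj : Function.Injective v := fun i j h => hvk (by simp [h])
  have hN := prod_eval_derivative_trinomial hodd hk hkn hk0 hvk hroot hu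
  rw [trinomial_eq_prod hkn hvinj hroot] at hN
  have hdet : frobenius (Matrix.vandermonde v).det = (Matrix.vandermonde v).det :=
    Matrix.map_det_vandermonde_of_finRotate hodd _ v hrot
  have hk8 : (8 : WittVector 2 K) ∣ k ^ k := by
    obtain ⟨m, hm⟩ := hk.two_dvd
    have h2 : (2 : WittVector 2 K) ∣ k := ⟨m, by rw [hm]; push_cast; rfl⟩
    refine dvd_trans ?_ (pow_dvd_pow_of_dvd h2 k)
    rw [show (8 : WittVector 2 K) = 2 ^ 3 by norm_num]
    exact pow_dvd_pow 2 (by omega)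
  have hn8 : (8 : ℤ) ∣ (n : ℤ) ^ n - n := by
    obtain ⟨m, hm⟩ := hodd
    have h1 : (8 : ℤ) ∣ (n : ℤ) ^ 2 - 1 :=
      Int.eight_dvd_sq_sub_one_of_odd (by exact_mod_cast (⟨m, hm⟩ : Odd n))
    have h2 : (n : ℤ) ^ 2 - 1 ∣ ((n : ℤ) ^ 2) ^ m - 1 := by
      simpa using sub_dvd_pow_sub_pow ((n : ℤ) ^ 2) 1 m
    have h3 : (n : ℤ) ^ n - n = n * (((n : ℤ) ^ 2) ^ m - 1) := by
      conv_lhs => rw [show (n : ℤ) ^ n = (n : ℤ) ^ (2 * m + 1) by rw [← hm]]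
      ring
    rw [h3]
    exact (h1.trans h2).mul_left _
  have hn8' : (8 : WittVector 2 K) ∣ n ^ n - n := by
    obtain ⟨c, hc⟩ := hn8
    exact ⟨c, by exact_mod_cast congrArg (Int.cast (R := WittVector 2 K)) hc⟩
  have hdet8 : (8 : WittVector 2 K) ∣ (Matrix.vandermonde v).det ^ 2 - 1 := by
    refine eight_dvd_sq_sub_one_of_frobenius_eq hdet ?_
    change WittVector.constantCoeff _ ≠ 0
    rw [RingHom.map_det, RingHom.mapMatrix_apply,
      show (Matrix.vandermonde v).map WittVector.constantCoeff =
        Matrix.vandermonde (fun i => WittVector.constantCoeff (v i)) by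
          ext i j : 2; exact map_pow WittVector.constantCoeff (v i) j, Matrix.det_vandermonde_ne_zero_iff]
    intro i j hij
    refine hvk (?_ : v i ^ k = v j ^ k)
    simp only [hvc] at hij
    have : i = j := pow_two_pow_injective hn (hK b) hb0 (fun h => hbk1 (by rw [h, one_pow])) hij
    rw [this]
  have hN8 : (8 : WittVector 2 K) ∣
      ∏ i, (derivative (∏ j, (X - C (v j)))).eval (v i) - n := by
    rw [hN]
    obtain ⟨c, hc⟩ := hn8'
    obtain ⟨d, hd⟩ := hk8
    exact ⟨c + ((n : WittVector 2 K) - k) ^ n * u ^ k * d, by rw [hd]; linear_combination hc⟩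
  rcases prod_eval_derivative_eq_or_neg v with h | h
  · refine Or.inl (eight_dvd_intCast (K := K) ?_)
    rw [h] at hN8
    have := dvd_sub hN8 hdet8
    have h1 := dvd_neg.2 this
    push_cast
    convert h1 using 1
    ring
  · refine Or.inr (eight_dvd_intCast (K := K) ?_)
    rw [h] at hN8
    have := (dvd_neg.2 (dvd_add hdet8 hN8))
    push_cast
    convert this using 1
    ring

open Polynomial in
theorem eight_dvd_of_irreducible_trinomial {n s : ℕ} (hn : n.Prime) (hn2 : n ≠ 2) (hs0 : 0 < s)
    (hsn : s < n) (hs2 : s ≠ 2) (hsn2 : s ≠ n - 2)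
    (hirr : Irreducible (X ^ n + X ^ s + 1 : (ZMod 2)[X])) :
    (8 : ℤ) ∣ n - 1 ∨ (8 : ℤ) ∣ n + 1 := by
  have hodd : Odd n := hn.odd_of_ne_two hn2
  set f : (ZMod 2)[X] := X ^ n + X ^ s + 1 with hf
  obtain ⟨hm, hd⟩ := trinomial_monic_and_natDegree (ZMod 2) hsn
  have : Fact (Irreducible f) := ⟨hirr⟩
  let pb := AdjoinRoot.powerBasis hirr.ne_zero
  have : Module.Finite (ZMod 2) (AdjoinRoot f) := pb.finite
  have : Finite (AdjoinRoot f) := Module.finite_of_finite (ZMod 2)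
  have : CharP (AdjoinRoot f) 2 := charP_of_injective_algebraMap' (ZMod 2) 2
  have hcard : Nat.card (AdjoinRoot f) = 2 ^ n := by
    rw [Module.natCard_eq_pow_finrank (K := ZMod 2), pb.finrank, AdjoinRoot.powerBasis_dim, hd,
      Nat.card_zmod]
  have hK (x : AdjoinRoot f) : x ^ 2 ^ n = x := by
    have := Fintype.ofFinite (AdjoinRoot f)
    rw [← hcard, Nat.card_eq_fintype_card, FiniteField.pow_card]
  have hroot : AdjoinRoot.root f ^ n + AdjoinRoot.root f ^ s + 1 = 0 := by
    simpa [hf] using AdjoinRoot.eval₂_root f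
  set b := AdjoinRoot.root f
  rcases Nat.even_or_odd s with hs | hs
  · refine eight_dvd_of_trinomial_root hn hodd hs ?_ hsn hK hroot
    obtain ⟨m, rfl⟩ := hs
    omega
  -- For odd `s`, `b⁻¹` is a root of the reciprocal trinomial, whose middle exponent `n - s` is
  -- even; `s ≠ n - 2` makes it at least 4.
  · have hb0 : b ≠ 0 := by
      intro h
      simp [h, hn.ne_zero, hs0.ne'] at hroot
    refine eight_dvd_of_trinomial_root (k := n - s) (b := b⁻¹) hn hodd
      (Nat.Odd.sub_odd hodd hs) ?_ (by omega) hK ?_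
    · obtain ⟨m, rfl⟩ := hs
      obtain ⟨l, rfl⟩ := hodd
      omega
    · have h : b ^ n * b⁻¹ ^ (n - s) = b ^ s := by
        rw [inv_pow, ← div_eq_mul_inv, div_eq_iff (pow_ne_zero _ hb0), ← pow_add]
        congr 1
        omega
      have h' : b ^ n * b⁻¹ ^ n = 1 := by rw [← mul_pow, mul_inv_cancel₀ hb0, one_pow]
      refine (mul_eq_zero.1 ?_).resolve_left (pow_ne_zero n hb0)
      linear_combination h + h' + hroot

theorem corollary2p2 (n s : ℕ) (hn : n.Prime)
    (hmod : (n : ℤ) ≡ 3 [ZMOD 8] ∨ (n : ℤ) ≡ -3 [ZMOD 8])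
    (hs0 : 0 < s) (hsn : s < n) (hs2 : s ≠ 2) (hsn2 : s ≠ n - 2) :
    ∃ f g : Polynomial (ZMod 2), 0 < f.natDegree ∧ 0 < g.natDegree ∧
      (Polynomial.X ^ n + Polynomial.X ^ s + 1 : Polynomial (ZMod 2)) = f * g := by
  obtain ⟨hm, hd⟩ := Polynomial.trinomial_monic_and_natDegree (ZMod 2) hsn
  by_contra! hred
  have hn2 : n ≠ 2 := by
    rintro rfl
    rcases hmod with h | h <;> revert h <;> decide
  have hirr : Irreducible
      (Polynomial.X ^ n + Polynomial.X ^ s + 1 : Polynomial (ZMod 2)) := by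
    refine hm.irreducible_iff_natDegree.2 ⟨?_, ?_⟩
    · intro h
      rw [h, Polynomial.natDegree_one] at hd
      exact hn.ne_zero hd.symm
    · intro f g _ _ hfg
      by_contra! h
      exact hred f g (Nat.pos_of_ne_zero h.1) (Nat.pos_of_ne_zero h.2) hfg.symm
  have h8 := eight_dvd_of_irreducible_trinomial hn hn2 hs0 hsn hs2 hsn2 hirr
  simp only [Int.ModEq] at hmod
  omega
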